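/- Consider a network in which an upstream link $e_0$ diverges into a corridor $e_1$ and a local street $e_2$. Link $e$ has length $\ell_e>0$, the time step is $\delta>0$, and the state $x=(x_{e_0},x_{e_1},x_{e_2})$ of traffic densities ranges over $\mathcal X=[0,\infty)\times[0,x^{\max}_{e_1}]\times[0,x^{\max}_{e_2}]$ with $x_{e_1}^{\max},x_{e_2}^{\max}>0$. Link $e$ has a continuous, non-decreasing, non-negative sending flow $f_e(x)=f_e(x_e)$ with $\frac{\delta}{\ell_e}f_e(x_e)\le x_e$. The maximum $Q_{e_0}$ of $f_{e_0}$ over $[0,\infty)$ exists, and $x^c_{e_0}:=\inf\{x_{e_0}\ge 0: f_{e_0}(x_{e_0})=Q_{e_0}\}$ is the critical density. For $e\in\{e_1,e_2\}$ there is a continuous, non-increasing, non-negative receiving flow $r_e(x)=r_e(x_e)$ on $[0,x_e^{\max}]$ with $x_e+\frac{\delta}{\ell_e}r_e(x_e)\le x_e^{\max}$. Drivers are guided to $e_1$ with ratio $\alpha(x)\in[0,1]$ and to $e_2$ with ratio $1-\alpha(x)$, where $\alpha$ is measurable and does not depend on $x_{e_0}$. Under the toll $p$ and in the state $x$, the compliance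 rates $C=(C_{e_1},C_{e_2})\in[0,1]^2$ have the law $\Gamma_{x,p}$, a Markov kernel in $x$ that does not depend on $x_{e_0}$. The flows from $e_0$ are $$q_{e_1}(x,p,C)=\min\{(\alpha(x) C_{e_1}+(1-\alpha(x))(1-C_{e_2}))f_{e_0}(x),\,r_{e_1}(x)\},$$ $$q_{e_2}(x,p,C)=\min\{((1-\alpha(x))C_{e_2}+\alpha(x)(1-C_{e_1}))f_{e_0}(x),\,r_{e_2}(x)\}.$$ The demands $D(t)\ge0$ are independent and identically distributed with finite mean $\bar D$. The state is the Markov chain $$X_{e_0}(t+1)=X_{e_0}(t)+\tfrac{\delta}{\ell_{e_0}}\Big(D(t)-\sum_{e\in\{e_1,e_2\}}q_e(X(t),p,C(t))\Big),$$ $$X_e(t+1)=X_e(t)+\tfrac{\delta}{\ell_e}\big(q_e(X(t),p,C(t))-f_e(X(t))\big),\quad e\in\{e_1,e_2\},$$ where, given the past and $X(t)=x$, $C(t)$ has law $\Gamma_{x,p}$ and $D(t)$ is independent of it. The system is stable if there is a $Z<\infty$ such that $\limsup_{t\to\infty}\frac1t\sum_{\tau<t}\mathbb E\|X(\tau)\|_1\le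 Z$ for every initial state in $\mathcal X$, and unstable otherwise. **Theorem.** Suppose that there are $\theta=(\theta_{e_1},\theta_{e_2})\in[0,1]^2$ and $\gamma\ge0$ such that $$\bar D-\sum_{e\in\{e_1,e_2\}}(1-\theta_e)\,\mathbb E[q_e(x,p,C)]-\sum_{e\in\{e_1,e_2\}}\theta_e f_e(x)\ge\gamma\qquad\text{for all }x\in\mathcal X\text{ with }x_{e_0}=x_{e_0}^c,$$ where $\mathbb E[q_e(x,p,C)]=\int q_e(x,p,c)\,\Gamma_{x,p}(\mathrm dc)$. Then the system is unstable. If moreover $\gamma>0$ or the demand is not almost surely constant, then $\frac1t\sum_{\tau<t}\mathbb E\|X(\tau)\|_1\to\infty$ from every initial state in $\mathcal X$. -/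

import Mathlib

open MeasureTheory ProbabilityTheory Filter Topology
open scoped NNReal ENNReal

/-- A traffic state: the densities on the links `e₀` (index `0`, upstream), `e₁` (index `1`,
corridor) and `e₂` (index `2`, local street). -/
abbrev TrafficState : Type := Fin 3 → ℝ

/-- A compliance vector: entry `0` (resp. `1`) is the fraction of the drivers guided to `e₁`
(resp. `e₂`) who follow the guidance. -/
abbrev ComplianceRates : Type := Fin 2 → ℝ

/-- The data of a network where the upstream link `e₀` diverges into the corridor `e₁` and the
local street `e₂`. Links are indexed by `Fin 3`; the two branches by `e : Fin 2`, the branch `e`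
being the link `e.succ`. Sending and receiving flows are given as functions on `ℝ`; only their
values at admissible densities matter. -/
structure TrafficNetwork where
  /-- length of a time step -/
  timeStep : ℝ
  timeStep_pos : 0 < timeStep
  /-- lengths of the links -/
  length : Fin 3 → ℝ
  length_pos : ∀ i, 0 < length i
  /-- jam densities of the two branches (the upstream link can store arbitrarily many vehicles) -/
  jam : Fin 2 → ℝ
  jam_pos : ∀ e, 0 < jam e
  /-- sending flows `f_e` -/
  sending : Fin 3 → ℝ → ℝ
  sending_continuous : ∀ i, Continuous (sending i)
  sending_mono : ∀ i, MonotoneOn (sending i) (Set.Ici 0)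
  sending_nonneg : ∀ i, ∀ s, 0 ≤ s → 0 ≤ sending i s
  /-- no link sends more vehicles in one time step than it holds -/
  sending_le : ∀ i, ∀ s, 0 ≤ s → timeStep / length i * sending i s ≤ s
  /-- the capacity of the upstream link, which is its maximal sending flow -/
  capacity : ℝ
  sending_le_capacity : ∀ s, 0 ≤ s → sending 0 s ≤ capacity
  capacity_attained : ∃ s, 0 ≤ s ∧ sending 0 s = capacity
  /-- receiving flows `r_e` of the two branches -/
  receiving : Fin 2 → ℝ → ℝ
  receiving_continuous : ∀ e, Continuous (receiving e)
  receiving_anti : ∀ e, AntitoneOn (receiving e) (Set.Icc 0 (jam e))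
  receiving_nonneg : ∀ e, ∀ s ∈ Set.Icc 0 (jam e), 0 ≤ receiving e s
  /-- no branch admits more vehicles in one time step than there is space for -/
  receiving_le : ∀ e, ∀ s ∈ Set.Icc 0 (jam e),
    s + timeStep / length e.succ * receiving e s ≤ jam e
  /-- routing policy: the fraction of the drivers who are guided to `e₁` -/
  routing : TrafficState → ℝ
  routing_measurable : Measurable routing
  routing_mem : ∀ x, routing x ∈ Set.Icc (0 : ℝ) 1
  /-- the guidance depends on the densities of the two branches only -/
  routing_congr : ∀ x y : TrafficState, (∀ e : Fin 2, x e.succ = y e.succ) → routing x = routing y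
  /-- `compliance p x` is the law `Γ_{x,p}` of the compliance rates in the state `x` under the
  toll `p` -/
  compliance : ℝ → Kernel TrafficState ComplianceRates
  compliance_markov : ∀ p, IsMarkovKernel (compliance p)
  compliance_mem : ∀ p x, ∀ᵐ c ∂(compliance p x), ∀ e, c e ∈ Set.Icc (0 : ℝ) 1
  /-- compliance depends on the densities of the two branches (and on the toll) only -/
  compliance_congr : ∀ p, ∀ x y : TrafficState, (∀ e : Fin 2, x e.succ = y e.succ) →
    compliance p x = compliance p y
  /-- common law of the independent demands `D(t)` -/
  demand : Measure ℝ
  demand_prob : IsProbabilityMeasure demand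
  demand_nonneg : ∀ᵐ d ∂demand, 0 ≤ d
  demand_integrable : Integrable (fun d : ℝ => d) demand

namespace TrafficNetwork

noncomputable section

variable (N : TrafficNetwork)

/-- The state space `𝒳 = [0, ∞) × [0, jam₁] × [0, jam₂]`. -/
def stateSpace : Set TrafficState :=
  {x | 0 ≤ x 0 ∧ ∀ e : Fin 2, x e.succ ∈ Set.Icc 0 (N.jam e)}

/-- The critical density of `e₀`: the least density at which `e₀` sends at capacity. -/
def criticalDensity : ℝ := sInf {s | 0 ≤ s ∧ N.sending 0 s = N.capacity}

/-- The mean demand. -/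
def meanDemand : ℝ := ∫ d, d ∂N.demand

/-- The fraction of the drivers leaving `e₀` who want to enter the branch `e`: those guided to `e`
who comply, together with those guided to the other branch who do not. -/
def share (x : TrafficState) (c : ComplianceRates) : Fin 2 → ℝ :=
  ![N.routing x * c 0 + (1 - N.routing x) * (1 - c 1),
    (1 - N.routing x) * c 1 + N.routing x * (1 - c 0)]

/-- The flow `q_e` from `e₀` into the branch `e`. -/
def flow (e : Fin 2) (x : TrafficState) (c : ComplianceRates) : ℝ :=
  min (N.share x c e * N.sending 0 (x 0)) (N.receiving e (x e.succ))

/-- One time step of the system (conservation of vehicles on each link). -/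
def step (x : TrafficState) (c : ComplianceRates) (d : ℝ) : TrafficState :=
  ![x 0 + N.timeStep / N.length 0 * (d - ∑ e, N.flow e x c),
    x 1 + N.timeStep / N.length 1 * (N.flow 0 x c - N.sending 1 (x 1)),
    x 2 + N.timeStep / N.length 2 * (N.flow 1 x c - N.sending 2 (x 2))]

/-- The expected flow `𝔼[q_e(x, p, C)] = ∫ q_e(x, p, c) Γ_{x,p}(dc)`. -/
def expectedFlow (p : ℝ) (e : Fin 2) (x : TrafficState) : ℝ :=
  ∫ c, N.flow e x c ∂(N.compliance p x)

/-- The transition kernel of the Markov chain `X(t+1) = step (X(t)) (C(t)) (D(t))`, where, given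
the past and `X(t) = x`, the rates `C(t)` have the law `Γ_{x,p}` and the demand `D(t)` is
independent of them with the law `demand`. -/
def transition (p : ℝ) : Kernel TrafficState TrafficState :=
  (Kernel.id ×ₖ (N.compliance p ×ₖ Kernel.const TrafficState N.demand)).map
    (fun z : TrafficState × ComplianceRates × ℝ => N.step z.1 z.2.1 z.2.2)

/-- The law of `X(t)` for the initial state `x`. -/
def stateLaw (p : ℝ) (x : TrafficState) : ℕ → Measure TrafficState
  | 0 => Measure.dirac x
  | t + 1 => (stateLaw p x t).bind (N.transition p)

/-- `𝔼[‖X(t)‖₁]` for the initial state `x`, as an extended nonnegative number. -/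
def meanDensity (p : ℝ) (x : TrafficState) (t : ℕ) : ℝ≥0∞ :=
  ∫⁻ y, ENNReal.ofReal (∑ i, |y i|) ∂(N.stateLaw p x t)

/-- `(1/t) ∑_{τ < t} 𝔼[‖X(τ)‖₁]` for the initial state `x`. -/
def averageDensity (p : ℝ) (x : TrafficState) (t : ℕ) : ℝ≥0∞ :=
  (∑ τ ∈ Finset.range t, N.meanDensity p x τ) / (t : ℝ≥0∞)

/-- Stability: the long-run average of the expected density is bounded, uniformly in the initial
state. -/
def Stable (p : ℝ) : Prop :=
  ∃ Z : ℝ≥0, ∀ x ∈ N.stateSpace, limsup (N.averageDensity p x) atTop ≤ (Z : ℝ≥0∞)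

/-- Instability is the failure of stability. -/
def Unstable (p : ℝ) : Prop := ¬ N.Stable p

/-- The weighted expected net flow in the state `x`, for the weights `θ`. -/
def netFlow (p : ℝ) (θ : Fin 2 → ℝ) (x : TrafficState) : ℝ :=
  N.meanDemand - ∑ e, (1 - θ e) * N.expectedFlow p e x
    - ∑ e : Fin 2, θ e * N.sending e.succ (x e.succ)

/-- The step map is measurable, so that `transition` is the genuine push-forward. -/
theorem measurable_step :
    Measurable (fun z : TrafficState × ComplianceRates × ℝ => N.step z.1 z.2.1 z.2.2) := by
  have h0 := N.routing_measurable
  have hf : ∀ i, Measurable (N.sending i) := fun i => (N.sending_continuous i).measurable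
  have hr : ∀ e, Measurable (N.receiving e) := fun e => (N.receiving_continuous e).measurable
  refine measurable_pi_lambda _ fun i => ?_
  fin_cases i <;> simp [step, flow, share, Fin.sum_univ_two] <;> fun_prop

end

end TrafficNetwork

/-!
Let `V` be the number of vehicles, those on `e₀` counted with weight `1` and those on the branch
`e` with weight `θ e` (`potential`). A vehicle moving from `e₀` to `e` lowers `V` by `1 - θ e`, one
leaving the branch `e` lowers it by `θ e`, so the drift of `V` is the net flow
(`integral_potential_transition`). For given branch densities the net flow is least when `e₀` sends
at capacity, which it does at the critical density; so the hypothesis bounds it below by `γ` on the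
whole state space (`le_netFlow`), which the chain never leaves. Hence `𝔼 V(X(t))` is nondecreasing,
and it starts from an arbitrarily large value when `e₀` is heavily loaded, while `V` is at most a
constant times `‖·‖₁`: no bound is uniform in the initial state.

For divergence from a given state it remains to show that `𝔼 V(X(t))` is unbounded
(`tendsto_meanPotential`). This is clear for `γ > 0`. For a non-constant demand, the convex function
`V + exp (-V)` is used instead of the convergence theorem for submartingales. The demand is
independent of the rest of the time step, so by strict convexity one step increases the expectation
of `V + exp (-V)` by at least `κ 𝔼 exp (-V)`, where `κ = 𝔼 D + log 𝔼 exp (-D) > 0`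
(`demandGap_pos`, `integral_convex_potential_add_le`). If `𝔼 V` were bounded by `M`, this would be at
least `κ exp (-M)` in every step, whereas `𝔼 (V + exp (-V)) ≤ M + 1`.
-/

namespace TrafficNetwork

noncomputable section

variable (N : TrafficNetwork)

instance isProbabilityMeasure_demand : IsProbabilityMeasure N.demand := N.demand_prob

instance isMarkovKernel_compliance (p : ℝ) : IsMarkovKernel (N.compliance p) :=
  N.compliance_markov p

/-! ### Flows and the invariant state space -/

lemma sum_share (x : TrafficState) (c : ComplianceRates) : ∑ e, N.share x c e = 1 := by
  simp [share, Fin.sum_univ_two]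
  ring

lemma share_nonneg (x : TrafficState) {c : ComplianceRates} (hc : ∀ e, c e ∈ Set.Icc (0 : ℝ) 1)
    (e : Fin 2) : 0 ≤ N.share x c e := by
  obtain ⟨ha0, ha1⟩ := N.routing_mem x
  have h0 := hc 0
  have h1 := hc 1
  have := sub_nonneg.2 ha1
  have := sub_nonneg.2 h0.2
  have := sub_nonneg.2 h1.2
  have := h0.1
  have := h1.1
  fin_cases e <;> simp [share] <;> positivity

lemma flow_mem {x : TrafficState} (hx : x ∈ N.stateSpace) {c : ComplianceRates}
    (hc : ∀ e, c e ∈ Set.Icc (0 : ℝ) 1) (e : Fin 2) :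
    N.flow e x c ∈ Set.Icc 0 (N.receiving e (x e.succ)) :=
  ⟨le_min (mul_nonneg (N.share_nonneg x hc e) (N.sending_nonneg 0 _ hx.1))
    (N.receiving_nonneg e _ (hx.2 e)), min_le_right _ _⟩

lemma sum_flow_le (x : TrafficState) (c : ComplianceRates) :
    ∑ e, N.flow e x c ≤ N.sending 0 (x 0) :=
  calc ∑ e, N.flow e x c ≤ ∑ e, N.share x c e * N.sending 0 (x 0) :=
        Finset.sum_le_sum fun _ _ => min_le_left _ _
    _ = N.sending 0 (x 0) := by rw [← Finset.sum_mul, sum_share, one_mul]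

lemma step_zero (x : TrafficState) (c : ComplianceRates) (d : ℝ) :
    N.step x c d 0 = x 0 + N.timeStep / N.length 0 * (d - ∑ e, N.flow e x c) := rfl

lemma step_succ (x : TrafficState) (c : ComplianceRates) (d : ℝ) (e : Fin 2) :
    N.step x c d e.succ = x e.succ +
      N.timeStep / N.length e.succ * (N.flow e x c - N.sending e.succ (x e.succ)) := by
  fin_cases e <;> rfl

lemma step_mem {x : TrafficState} (hx : x ∈ N.stateSpace) {c : ComplianceRates}
    (hc : ∀ e, c e ∈ Set.Icc (0 : ℝ) 1) {d : ℝ} (hd : 0 ≤ d) :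
    N.step x c d ∈ N.stateSpace := by
  have hpos : ∀ i, 0 < N.timeStep / N.length i := fun i => div_pos N.timeStep_pos (N.length_pos i)
  refine ⟨?_, fun e => ⟨?_, ?_⟩⟩
  · rw [step_zero]
    have h1 := N.sending_le 0 _ hx.1
    have h2 := mul_le_mul_of_nonneg_left (N.sum_flow_le x c) (hpos 0).le
    have h3 := mul_nonneg (hpos 0).le hd
    rw [mul_sub]
    linarith
  · rw [step_succ, mul_sub]
    have h1 := N.sending_le e.succ _ (hx.2 e).1
    have h2 := mul_nonneg (hpos e.succ).le (N.flow_mem hx hc e).1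
    linarith
  · rw [step_succ, mul_sub]
    have h1 := N.receiving_le e _ (hx.2 e)
    have h2 := mul_le_mul_of_nonneg_left (N.flow_mem hx hc e).2 (hpos e.succ).le
    have h3 := mul_nonneg (hpos e.succ).le (N.sending_nonneg e.succ _ (hx.2 e).1)
    linarith

lemma measurableSet_stateSpace : MeasurableSet N.stateSpace := by
  have h : N.stateSpace = {x | 0 ≤ x 0} ∩ ⋂ e : Fin 2, {x | x e.succ ∈ Set.Icc 0 (N.jam e)} := by
    ext x
    simp [stateSpace]
  rw [h]
  exact (measurableSet_le measurable_const (measurable_pi_apply 0)).inter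
    (MeasurableSet.iInter fun e => measurable_pi_apply _ measurableSet_Icc)

lemma measurable_flow (e : Fin 2) (x : TrafficState) : Measurable (N.flow e x) := by
  unfold flow
  fin_cases e <;> simp [share] <;> fun_prop

lemma integrable_flow (p : ℝ) {x : TrafficState} (hx : x ∈ N.stateSpace) (e : Fin 2) :
    Integrable (N.flow e x) (N.compliance p x) :=
  .of_mem_Icc _ _ (N.measurable_flow e x).aemeasurable
    ((N.compliance_mem p x).mono fun _ hc => N.flow_mem hx hc e)

/-! ### The drift -/

lemma criticalDensity_mem :
    N.criticalDensity ∈ {s | 0 ≤ s ∧ N.sending 0 s = N.capacity} :=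
  (isClosed_Ici.inter (isClosed_eq (N.sending_continuous 0) continuous_const)).csInf_mem
    N.capacity_attained ⟨0, fun _ hs => hs.1⟩

/-- The branch densities being equal, the net flow is least when the upstream link is at its
critical density, because it then sends at capacity. -/
lemma le_netFlow {p γ : ℝ} {θ : Fin 2 → ℝ} (hθ : ∀ e, θ e ∈ Set.Icc (0 : ℝ) 1)
    (hflow : ∀ x ∈ N.stateSpace, x 0 = N.criticalDensity → γ ≤ N.netFlow p θ x)
    {x : TrafficState} (hx : x ∈ N.stateSpace) : γ ≤ N.netFlow p θ x := by
  set y : TrafficState := Function.update x 0 N.criticalDensity with hy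
  have hys : ∀ e : Fin 2, y e.succ = x e.succ := fun e =>
    Function.update_of_ne (Fin.succ_ne_zero e) _ _
  have hy0 : y 0 = N.criticalDensity := Function.update_self _ _ _
  have hyS : y ∈ N.stateSpace :=
    ⟨hy0 ▸ N.criticalDensity_mem.1, fun e => (hys e).symm ▸ hx.2 e⟩
  refine (hflow y hyS hy0).trans ?_
  have hle : ∀ e, N.expectedFlow p e x ≤ N.expectedFlow p e y := by
    intro e
    rw [expectedFlow, expectedFlow, N.compliance_congr p y x hys]
    refine integral_mono_ae (N.integrable_flow p hx e)
      (N.compliance_congr p y x hys ▸ N.integrable_flow p hyS e) ?_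
    filter_upwards [N.compliance_mem p x] with c hc
    have hshare : N.share y c = N.share x c := by simp [share, N.routing_congr y x hys]
    rw [flow, flow, hys, hshare, hy0, N.criticalDensity_mem.2]
    exact min_le_min_right _ (mul_le_mul_of_nonneg_left (N.sending_le_capacity _ hx.1)
      (N.share_nonneg x hc e))
  have hsum : ∑ e, (1 - θ e) * N.expectedFlow p e x ≤ ∑ e, (1 - θ e) * N.expectedFlow p e y :=
    Finset.sum_le_sum fun e _ => mul_le_mul_of_nonneg_left (hle e) (sub_nonneg.2 (hθ e).2)
  simp only [netFlow, hys]
  linarith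

/-- The weighted number of vehicles, in units of `timeStep`: those on `e₀` have weight `1`, those
on the branch `e` have weight `θ e`. -/
def potential (θ : Fin 2 → ℝ) (x : TrafficState) : ℝ :=
  (N.length 0 * x 0 + ∑ e : Fin 2, θ e * (N.length e.succ * x e.succ)) / N.timeStep

/-- The weighted number of vehicles that leave in one time step: a transfer from `e₀` to the
branch `e` loses the weight `1 - θ e`, a departure from the branch `e` the weight `θ e`. -/
def outflow (θ : Fin 2 → ℝ) (x : TrafficState) (c : ComplianceRates) : ℝ :=
  ∑ e, (1 - θ e) * N.flow e x c + ∑ e : Fin 2, θ e * N.sending e.succ (x e.succ)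

lemma potential_step (θ : Fin 2 → ℝ) (x : TrafficState) (c : ComplianceRates) (d : ℝ) :
    N.potential θ (N.step x c d) = N.potential θ x + (d - N.outflow θ x c) := by
  have := N.timeStep_pos.ne'
  have := fun i => (N.length_pos i).ne'
  have h0 := this 0
  have h1 := this 1
  have h2 := this 2
  simp only [potential, outflow, step_zero, step_succ, Fin.sum_univ_two]
  simp only [Fin.succ_zero_eq_one, Fin.succ_one_eq_two]
  field_simp
  ring

lemma measurable_potential (θ : Fin 2 → ℝ) : Measurable (N.potential θ) := by
  unfold potential
  fun_prop

lemma potential_nonneg {θ : Fin 2 → ℝ} (hθ : ∀ e, θ e ∈ Set.Icc (0 : ℝ) 1) {x : TrafficState}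
    (hx : x ∈ N.stateSpace) : 0 ≤ N.potential θ x := by
  refine div_nonneg (add_nonneg (mul_nonneg (N.length_pos 0).le hx.1) ?_) N.timeStep_pos.le
  exact Finset.sum_nonneg fun e _ =>
    mul_nonneg (hθ e).1 (mul_nonneg (N.length_pos _).le (hx.2 e).1)

lemma potential_le {θ : Fin 2 → ℝ} (hθ : ∀ e, θ e ∈ Set.Icc (0 : ℝ) 1) (x : TrafficState) :
    N.potential θ x ≤ (∑ i, N.length i) / N.timeStep * ∑ i, |x i| := by
  rw [div_mul_eq_mul_div]
  refine div_le_div_of_nonneg_right ?_ N.timeStep_pos.le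
  rw [Finset.sum_mul, Fin.sum_univ_succ (fun i => N.length i * _)]
  have hle : ∀ i, N.length i * x i ≤ N.length i * ∑ j, |x j| := fun i =>
    mul_le_mul_of_nonneg_left ((le_abs_self _).trans
      (Finset.single_le_sum (fun j _ => abs_nonneg (x j)) (Finset.mem_univ i))) (N.length_pos i).le
  have hnn : ∀ i, 0 ≤ N.length i * ∑ j, |x j| := fun i =>
    mul_nonneg (N.length_pos i).le (Finset.sum_nonneg fun j _ => abs_nonneg _)
  refine add_le_add (hle 0) (Finset.sum_le_sum fun e _ => ?_)
  calc θ e * (N.length e.succ * x e.succ)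
      ≤ θ e * (N.length e.succ * ∑ j, |x j|) := mul_le_mul_of_nonneg_left (hle _) (hθ e).1
    _ ≤ N.length e.succ * ∑ j, |x j| := mul_le_of_le_one_left (hnn _) (hθ e).2

lemma measurable_outflow (θ : Fin 2 → ℝ) (x : TrafficState) : Measurable (N.outflow θ x) := by
  have := fun e => N.measurable_flow e x
  unfold outflow
  fun_prop

lemma outflow_mem {θ : Fin 2 → ℝ} (hθ : ∀ e, θ e ∈ Set.Icc (0 : ℝ) 1) {x : TrafficState}
    (hx : x ∈ N.stateSpace) {c : ComplianceRates} (hc : ∀ e, c e ∈ Set.Icc (0 : ℝ) 1) :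
    N.outflow θ x c ∈ Set.Icc 0 (∑ e, (1 - θ e) * N.receiving e (x e.succ) +
      ∑ e : Fin 2, θ e * N.sending e.succ (x e.succ)) := by
  have h1 : ∀ e, 0 ≤ 1 - θ e := fun e => sub_nonneg.2 (hθ e).2
  constructor
  · exact add_nonneg
      (Finset.sum_nonneg fun e _ => mul_nonneg (h1 e) (N.flow_mem hx hc e).1)
      (Finset.sum_nonneg fun e _ => mul_nonneg (hθ e).1 (N.sending_nonneg _ _ (hx.2 e).1))
  · exact add_le_add_left (Finset.sum_le_sum fun e _ =>
      mul_le_mul_of_nonneg_left (N.flow_mem hx hc e).2 (h1 e)) _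

lemma integrable_outflow (p : ℝ) {θ : Fin 2 → ℝ} (hθ : ∀ e, θ e ∈ Set.Icc (0 : ℝ) 1)
    {x : TrafficState} (hx : x ∈ N.stateSpace) :
    Integrable (N.outflow θ x) (N.compliance p x) :=
  .of_mem_Icc _ _ (N.measurable_outflow θ x).aemeasurable
    ((N.compliance_mem p x).mono fun _ hc => N.outflow_mem hθ hx hc)

lemma integrable_exp_outflow (p : ℝ) {θ : Fin 2 → ℝ} (hθ : ∀ e, θ e ∈ Set.Icc (0 : ℝ) 1)
    {x : TrafficState} (hx : x ∈ N.stateSpace) :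
    Integrable (fun c => Real.exp (N.outflow θ x c)) (N.compliance p x) :=
  .of_mem_Icc _ _ (N.measurable_outflow θ x).exp.aemeasurable
    ((N.compliance_mem p x).mono fun _ hc => ⟨(Real.exp_pos _).le,
      Real.exp_le_exp.2 (N.outflow_mem hθ hx hc).2⟩)

lemma integral_outflow (p : ℝ) (θ : Fin 2 → ℝ) {x : TrafficState} (hx : x ∈ N.stateSpace) :
    ∫ c, N.outflow θ x c ∂(N.compliance p x) = N.meanDemand - N.netFlow p θ x := by
  have hi : ∀ e : Fin 2, Integrable (fun c => (1 - θ e) * N.flow e x c) (N.compliance p x) :=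
    fun e => (N.integrable_flow p hx e).const_mul _
  simp only [outflow]
  rw [integral_add (integrable_finsetSum _ fun e _ => hi e) (integrable_const _),
    integral_finsetSum _ fun e _ => hi e]
  simp only [integral_const_mul, netFlow, expectedFlow, integral_const, probReal_univ, one_smul]
  ring

/-! ### One step of the chain -/

lemma transition_apply (p : ℝ) (x : TrafficState) :
    N.transition p x = ((N.compliance p x).prod N.demand).map (fun z => N.step x z.1 z.2) := by
  rw [transition, Kernel.map_apply _ N.measurable_step, Kernel.prod_apply, Kernel.prod_apply,
    Kernel.id_apply, Kernel.const_apply, Measure.dirac_prod,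
    Measure.map_map N.measurable_step measurable_prodMk_left]
  rfl

lemma measurable_step_right (x : TrafficState) :
    Measurable (fun z : ComplianceRates × ℝ => N.step x z.1 z.2) :=
  N.measurable_step.comp measurable_prodMk_left

instance isMarkovKernel_transition (p : ℝ) : IsMarkovKernel (N.transition p) :=
  Kernel.IsMarkovKernel.map _ N.measurable_step

lemma ae_transition_mem (p : ℝ) {x : TrafficState} (hx : x ∈ N.stateSpace) :
    ∀ᵐ y ∂(N.transition p x), y ∈ N.stateSpace := by
  rw [transition_apply]
  refine (ae_map_iff (N.measurable_step_right x).aemeasurable N.measurableSet_stateSpace).2 ?_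
  filter_upwards [Measure.quasiMeasurePreserving_fst.ae (N.compliance_mem p x),
    Measure.quasiMeasurePreserving_snd.ae N.demand_nonneg] with z hc hd
  exact N.step_mem hx hc hd

lemma integrable_potential_transition (p : ℝ) {θ : Fin 2 → ℝ}
    (hθ : ∀ e, θ e ∈ Set.Icc (0 : ℝ) 1) {x : TrafficState} (hx : x ∈ N.stateSpace) :
    Integrable (N.potential θ) (N.transition p x) := by
  rw [transition_apply, integrable_map_measure (N.measurable_potential θ).aestronglyMeasurable
    (N.measurable_step_right x).aemeasurable]
  simp only [Function.comp_def, potential_step]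
  exact (integrable_const _).add ((N.demand_integrable.comp_snd _).sub
    ((N.integrable_outflow p hθ hx).comp_fst _))

/-- The drift of the potential is the net flow. -/
lemma integral_potential_transition (p : ℝ) {θ : Fin 2 → ℝ}
    (hθ : ∀ e, θ e ∈ Set.Icc (0 : ℝ) 1) {x : TrafficState} (hx : x ∈ N.stateSpace) :
    ∫ y, N.potential θ y ∂(N.transition p x) = N.potential θ x + N.netFlow p θ x := by
  rw [transition_apply, integral_map (N.measurable_step_right x).aemeasurable
    (N.measurable_potential θ).aestronglyMeasurable]
  simp only [potential_step]
  have h1 := N.demand_integrable.comp_snd (N.compliance p x)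
  have h2 := (N.integrable_outflow p hθ hx).comp_fst N.demand
  have h3 : Integrable (fun z : ComplianceRates × ℝ => z.2 - N.outflow θ x z.1)
    ((N.compliance p x).prod N.demand) := h1.sub h2
  rw [integral_add (integrable_const _) h3, integral_sub h1 h2,
    integral_fun_snd (fun d : ℝ => d), integral_fun_fst (N.outflow θ x), N.integral_outflow p θ hx]
  simp [meanDemand]

/-- The gap in Jensen's inequality `exp (-𝔼 D) ≤ 𝔼 [exp (-D)]` for the demand `D`, on a
logarithmic scale. -/
def demandGap : ℝ := N.meanDemand + Real.log (∫ d, Real.exp (-d) ∂N.demand)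

lemma integrable_exp_neg_demand : Integrable (fun d : ℝ => Real.exp (-d)) N.demand :=
  .of_mem_Icc 0 1 (by fun_prop) (N.demand_nonneg.mono fun d hd =>
    ⟨(Real.exp_pos _).le, Real.exp_le_one_iff.2 (neg_nonpos.2 hd)⟩)

/-- The demand enters a time step independently of everything else, so the expectation of
`exp (-potential)` factorizes. -/
lemma integral_exp_neg_potential_transition (p : ℝ) (θ : Fin 2 → ℝ) (x : TrafficState) :
    ∫ y, Real.exp (-N.potential θ y) ∂(N.transition p x) =
      Real.exp (-N.potential θ x) * ((∫ c, Real.exp (N.outflow θ x c) ∂(N.compliance p x)) *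
        ∫ d, Real.exp (-d) ∂N.demand) := by
  rw [transition_apply, integral_map (N.measurable_step_right x).aemeasurable
    (f := fun y => Real.exp (-N.potential θ y))
    (by have := N.measurable_potential θ; fun_prop), ← integral_prod_mul,
    ← integral_const_mul]
  refine integral_congr_ae (.of_forall fun z => ?_)
  simp only [potential_step, ← Real.exp_add]
  ring_nf

lemma le_integral_exp_neg_potential_transition (p : ℝ) {θ : Fin 2 → ℝ}
    (hθ : ∀ e, θ e ∈ Set.Icc (0 : ℝ) 1) {x : TrafficState} (hx : x ∈ N.stateSpace) :
    Real.exp (-N.potential θ x) * (1 - N.netFlow p θ x + N.demandGap) ≤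
      ∫ y, Real.exp (-N.potential θ y) ∂(N.transition p x) := by
  rw [integral_exp_neg_potential_transition]
  refine mul_le_mul_of_nonneg_left ?_ (Real.exp_pos _).le
  set L := ∫ d, Real.exp (-d) ∂N.demand with hL
  have hLpos : 0 < L := integral_exp_pos N.integrable_exp_neg_demand
  have ho := N.integrable_outflow p hθ hx
  calc 1 - N.netFlow p θ x + N.demandGap
      = ∫ c, (N.outflow θ x c + (Real.log L + 1)) ∂(N.compliance p x) := by
        rw [integral_add ho (integrable_const _), N.integral_outflow p θ hx, demandGap, ← hL]
        simp
        ring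
    _ ≤ ∫ c, Real.exp (N.outflow θ x c) * L ∂(N.compliance p x) := by
        refine integral_mono (ho.add (integrable_const _))
          ((N.integrable_exp_outflow p hθ hx).mul_const _) fun c => ?_
        have h := Real.add_one_le_exp (N.outflow θ x c + Real.log L)
        rw [Real.exp_add, Real.exp_log hLpos] at h
        change N.outflow θ x c + (Real.log L + 1) ≤ _
        linarith
    _ = _ := integral_mul_const _ _

/-- The gap vanishes only for a constant demand. With `a = log 𝔼 [exp (-D)]`, it is the expectation
of the nonnegative variable `exp (-D - a) - 1 + D + a`, which is zero exactly where `D = -a`. -/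
lemma demandGap_pos (hD : ∀ d : ℝ, N.demand ≠ Measure.dirac d) : 0 < N.demandGap := by
  set L := ∫ d, Real.exp (-d) ∂N.demand with hL
  have hLpos : 0 < L := integral_exp_pos N.integrable_exp_neg_demand
  set a := Real.log L with ha
  have hI := N.integrable_exp_neg_demand
  have h1 : Integrable (fun d : ℝ => Real.exp (-d) / L - 1) N.demand :=
    (hI.div_const L).sub (integrable_const _)
  have h2 : Integrable (fun d : ℝ => d + a) N.demand :=
    N.demand_integrable.add (integrable_const _)
  have hint : Integrable (fun d : ℝ => Real.exp (-d) / L - 1 + (d + a)) N.demand := h1.add h2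
  have hexp : ∀ d, Real.exp (-d - a) = Real.exp (-d) / L := fun d => by
    rw [Real.exp_sub, Real.exp_log hLpos]
  have hnn : ∀ d, 0 ≤ Real.exp (-d) / L - 1 + (d + a) := fun d => by
    have := Real.add_one_le_exp (-d - a)
    rw [hexp] at this
    linarith
  have heq : ∫ d, (Real.exp (-d) / L - 1 + (d + a)) ∂N.demand = N.demandGap := by
    rw [integral_add h1 h2, integral_sub (hI.div_const L) (integrable_const _),
      integral_add N.demand_integrable (integrable_const _), integral_div, ← hL, div_self hLpos.ne']
    simp [demandGap, meanDemand, ← hL, ← ha]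
  rw [← heq]
  refine lt_of_le_of_ne (integral_nonneg hnn) fun h0 => hD (-a) ?_
  have hae : ∀ᵐ d ∂N.demand, d = -a := by
    filter_upwards [(integral_eq_zero_iff_of_nonneg hnn hint).1 h0.symm] with d hd
    by_contra hne
    have := Real.add_one_lt_exp (x := -d - a) (fun h => hne (by linarith))
    rw [hexp] at this
    simp only [Pi.zero_apply] at hd
    linarith
  calc N.demand = N.demand.map (fun d => d) := Measure.map_id.symm
    _ = N.demand.map (fun _ => -a) := Measure.map_congr hae
    _ = Measure.dirac (-a) := by simp

/-! ### The law of the chain -/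

instance isProbabilityMeasure_stateLaw (p : ℝ) (x : TrafficState) (t : ℕ) :
    IsProbabilityMeasure (N.stateLaw p x t) := by
  induction t with
  | zero => exact Measure.dirac.isProbabilityMeasure
  | succ t ih => rw [stateLaw]; infer_instance

lemma ae_stateLaw_mem (p : ℝ) {x : TrafficState} (hx : x ∈ N.stateSpace) (t : ℕ) :
    ∀ᵐ y ∂(N.stateLaw p x t), y ∈ N.stateSpace := by
  induction t with
  | zero => exact (ae_dirac_iff N.measurableSet_stateSpace).2 hx
  | succ t ih =>
    exact Measure.ae_comp_of_ae_ae N.measurableSet_stateSpace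
      (ih.mono fun y hy => N.ae_transition_mem p hy)

lemma stateLaw_succ (p : ℝ) (x : TrafficState) (t : ℕ) :
    N.stateLaw p x (t + 1) =
      (N.transition p ∘ₖ Kernel.const Unit (N.stateLaw p x t)) () := by
  rw [← Measure.comp_eq_comp_const_apply, stateLaw]

lemma integrable_integral_transition {p : ℝ} {x : TrafficState} {t : ℕ} {f : TrafficState → ℝ}
    (hf : Integrable f (N.stateLaw p x (t + 1))) :
    Integrable (fun y => ∫ z, f z ∂(N.transition p y)) (N.stateLaw p x t) := by
  rw [stateLaw_succ] at hf
  simpa using hf.integral_comp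

lemma integral_stateLaw_succ {p : ℝ} {x : TrafficState} {t : ℕ} {f : TrafficState → ℝ}
    (hf : Integrable f (N.stateLaw p x (t + 1))) :
    ∫ z, f z ∂(N.stateLaw p x (t + 1)) =
      ∫ y, ∫ z, f z ∂(N.transition p y) ∂(N.stateLaw p x t) := by
  rw [stateLaw_succ] at hf ⊢
  simpa using Kernel.integral_comp hf

lemma netFlow_le_meanDemand (p : ℝ) {θ : Fin 2 → ℝ} (hθ : ∀ e, θ e ∈ Set.Icc (0 : ℝ) 1)
    {x : TrafficState} (hx : x ∈ N.stateSpace) : N.netFlow p θ x ≤ N.meanDemand := by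
  have h := integral_nonneg_of_ae (μ := N.compliance p x) (f := N.outflow θ x)
    ((N.compliance_mem p x).mono fun _ hc => (N.outflow_mem hθ hx hc).1)
  rw [N.integral_outflow p θ hx] at h
  linarith

lemma integrable_potential (p : ℝ) {θ : Fin 2 → ℝ} (hθ : ∀ e, θ e ∈ Set.Icc (0 : ℝ) 1)
    {x : TrafficState} (hx : x ∈ N.stateSpace) (t : ℕ) :
    Integrable (N.potential θ) (N.stateLaw p x t) := by
  induction t with
  | zero => exact integrable_dirac' (N.measurable_potential θ).stronglyMeasurable (by simp)
  | succ t ih =>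
    have hV := (N.measurable_potential θ).stronglyMeasurable
    refine (Measure.integrable_comp_iff hV.aestronglyMeasurable).2
      ⟨(N.ae_stateLaw_mem p hx t).mono fun y hy => N.integrable_potential_transition p hθ hy, ?_⟩
    refine (ih.add (integrable_const N.meanDemand)).mono'
      hV.norm.integral_kernel.aestronglyMeasurable ?_
    filter_upwards [N.ae_stateLaw_mem p hx t] with y hy
    have hnorm : ∫ z, ‖N.potential θ z‖ ∂(N.transition p y) =
        ∫ z, N.potential θ z ∂(N.transition p y) :=
      integral_congr_ae ((N.ae_transition_mem p hy).mono fun z hz =>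
        Real.norm_of_nonneg (N.potential_nonneg hθ hz))
    rw [Real.norm_of_nonneg (integral_nonneg fun _ => norm_nonneg _), hnorm,
      N.integral_potential_transition p hθ hy]
    exact add_le_add_right (N.netFlow_le_meanDemand p hθ hy) _

lemma integrable_exp_neg_potential {θ : Fin 2 → ℝ} (hθ : ∀ e, θ e ∈ Set.Icc (0 : ℝ) 1)
    {μ : Measure TrafficState} [IsFiniteMeasure μ] (hμ : ∀ᵐ y ∂μ, y ∈ N.stateSpace) :
    Integrable (fun y => Real.exp (-N.potential θ y)) μ :=
  .of_mem_Icc 0 1 (N.measurable_potential θ).neg.exp.aemeasurable (hμ.mono fun _ hy =>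
    ⟨(Real.exp_pos _).le, Real.exp_le_one_iff.2 (neg_nonpos.2 (N.potential_nonneg hθ hy))⟩)

/-- The expected potential at time `t`. -/
def meanPotential (p : ℝ) (θ : Fin 2 → ℝ) (x : TrafficState) (t : ℕ) : ℝ :=
  ∫ y, N.potential θ y ∂(N.stateLaw p x t)

lemma meanPotential_zero (p : ℝ) (θ : Fin 2 → ℝ) (x : TrafficState) :
    N.meanPotential p θ x 0 = N.potential θ x :=
  integral_dirac' _ _ (N.measurable_potential θ).stronglyMeasurable

lemma meanPotential_add_le {p γ : ℝ} {θ : Fin 2 → ℝ} (hθ : ∀ e, θ e ∈ Set.Icc (0 : ℝ) 1)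
    (hflow : ∀ x ∈ N.stateSpace, γ ≤ N.netFlow p θ x)
    {x : TrafficState} (hx : x ∈ N.stateSpace) (t : ℕ) :
    N.meanPotential p θ x t + γ ≤ N.meanPotential p θ x (t + 1) := by
  have hI := N.integrable_potential p hθ hx
  calc N.meanPotential p θ x t + γ = ∫ y, (N.potential θ y + γ) ∂(N.stateLaw p x t) := by
        rw [integral_add (hI t) (integrable_const _)]
        simp [meanPotential]
    _ ≤ ∫ y, ∫ z, N.potential θ z ∂(N.transition p y) ∂(N.stateLaw p x t) := by
        refine integral_mono_ae ((hI t).add (integrable_const _)) (N.integrable_integral_transition (hI (t + 1))) ?_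
        filter_upwards [N.ae_stateLaw_mem p hx t] with y hy
        change _ ≤ ∫ z, N.potential θ z ∂(N.transition p y)
        rw [N.integral_potential_transition p hθ hy]
        exact add_le_add_right (hflow y hy) _
    _ = N.meanPotential p θ x (t + 1) := (N.integral_stateLaw_succ (hI (t + 1))).symm

/-- The convex function `v + exp (-v)` of the potential gains in expectation from the drift of the
potential, which its slope `1 - exp (-v)` preserves in sign, and from the randomness of the
demand. -/
lemma integral_convex_potential_add_le {p : ℝ} {θ : Fin 2 → ℝ}
    (hθ : ∀ e, θ e ∈ Set.Icc (0 : ℝ) 1) (hflow : ∀ x ∈ N.stateSpace, 0 ≤ N.netFlow p θ x)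
    {x : TrafficState} (hx : x ∈ N.stateSpace) (t : ℕ) :
    ∫ y, (N.potential θ y + Real.exp (-N.potential θ y)) ∂(N.stateLaw p x t) +
        N.demandGap * ∫ y, Real.exp (-N.potential θ y) ∂(N.stateLaw p x t) ≤
      ∫ y, (N.potential θ y + Real.exp (-N.potential θ y)) ∂(N.stateLaw p x (t + 1)) := by
  have hE : ∀ t, Integrable (fun y => Real.exp (-N.potential θ y)) (N.stateLaw p x t) :=
    fun t => N.integrable_exp_neg_potential hθ (N.ae_stateLaw_mem p hx t)
  have hI : ∀ t, Integrable (fun y => N.potential θ y + Real.exp (-N.potential θ y))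
      (N.stateLaw p x t) := fun t => (N.integrable_potential p hθ hx t).add (hE t)
  rw [← integral_const_mul, ← integral_add (hI t) ((hE t).const_mul _)]
  calc _ ≤ ∫ y, ∫ z, (N.potential θ z + Real.exp (-N.potential θ z)) ∂(N.transition p y)
        ∂(N.stateLaw p x t) := by
        refine integral_mono_ae ((hI t).add ((hE t).const_mul _)) (N.integrable_integral_transition (hI (t + 1))) ?_
        filter_upwards [N.ae_stateLaw_mem p hx t] with y hy
        change _ ≤ ∫ z, (N.potential θ z + Real.exp (-N.potential θ z)) ∂(N.transition p y)
        rw [integral_add (N.integrable_potential_transition p hθ hy)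
          (N.integrable_exp_neg_potential hθ (N.ae_transition_mem p hy)),
          N.integral_potential_transition p hθ hy]
        have h1 := N.le_integral_exp_neg_potential_transition p hθ hy
        have h2 : 0 ≤ (1 - Real.exp (-N.potential θ y)) * N.netFlow p θ y :=
          mul_nonneg (sub_nonneg.2 (Real.exp_le_one_iff.2
            (neg_nonpos.2 (N.potential_nonneg hθ hy)))) (hflow y hy)
        linarith
    _ = _ := (N.integral_stateLaw_succ (hI (t + 1))).symm

/-! ### Growth of the expected density -/

lemma tendsto_meanPotential {p γ : ℝ} {θ : Fin 2 → ℝ} (hθ : ∀ e, θ e ∈ Set.Icc (0 : ℝ) 1)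
    (hγ : 0 ≤ γ) (hflow : ∀ x ∈ N.stateSpace, γ ≤ N.netFlow p θ x)
    (h : 0 < γ ∨ ∀ d : ℝ, N.demand ≠ Measure.dirac d)
    {x : TrafficState} (hx : x ∈ N.stateSpace) :
    Tendsto (N.meanPotential p θ x) atTop atTop := by
  have hstep := N.meanPotential_add_le hθ hflow hx
  have hmono : Monotone (N.meanPotential p θ x) :=
    monotone_nat_of_le_succ fun t => by linarith [hstep t]
  refine tendsto_atTop_atTop_of_monotone hmono fun M => ?_
  by_contra! hM
  -- A sequence that gains at least a fixed positive amount in each step is unbounded.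
  have hgrow : ∀ (u : ℕ → ℝ) (κ B : ℝ), 0 < κ → (∀ t, u t + κ ≤ u (t + 1)) →
      (∀ t, u t ≤ B) → False := by
    intro u κ B hκ hu hB
    have hlin : ∀ t : ℕ, u 0 + t * κ ≤ u t := by
      intro t
      induction t with
      | zero => simp
      | succ t ih =>
        push_cast
        linarith [hu t]
    obtain ⟨n, hn⟩ := exists_nat_gt ((B - u 0) / κ)
    rw [div_lt_iff₀ hκ] at hn
    linarith [hlin n, hB n]
  rcases h with hpos | hD
  · exact hgrow _ γ M hpos hstep fun t => (hM t).le
  have hI := N.integrable_potential p hθ hx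
  have hE : ∀ t, Integrable (fun y => Real.exp (-N.potential θ y)) (N.stateLaw p x t) :=
    fun t => N.integrable_exp_neg_potential hθ (N.ae_stateLaw_mem p hx t)
  have hgap := N.demandGap_pos hD
  refine hgrow (fun t => ∫ y, (N.potential θ y + Real.exp (-N.potential θ y))
    ∂(N.stateLaw p x t)) (N.demandGap * Real.exp (-M)) (M + 1)
    (mul_pos hgap (Real.exp_pos _)) (fun t => ?_) fun t => ?_
  · refine le_trans ?_
      (N.integral_convex_potential_add_le hθ (fun y hy => hγ.trans (hflow y hy)) hx t)
    refine add_le_add_right (mul_le_mul_of_nonneg_left ?_ hgap.le) _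
    -- Integrate the tangent of `exp (-v)` at `v = M`; the mean of `v` is at most `M`.
    have htan : ∫ y, Real.exp (-M) * (1 + M - N.potential θ y) ∂(N.stateLaw p x t) ≤
        ∫ y, Real.exp (-N.potential θ y) ∂(N.stateLaw p x t) := by
      refine integral_mono (((integrable_const _).sub (hI t)).const_mul _) (hE t) fun y => ?_
      have hexp := Real.add_one_le_exp (M - N.potential θ y)
      calc Real.exp (-M) * (1 + M - N.potential θ y)
          ≤ Real.exp (-M) * Real.exp (M - N.potential θ y) :=
            mul_le_mul_of_nonneg_left (by linarith) (Real.exp_pos _).le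
        _ = Real.exp (-N.potential θ y) := by
            rw [← Real.exp_add]
            ring_nf
    refine le_trans ?_ htan
    rw [integral_const_mul, integral_sub (integrable_const _) (hI t), integral_const,
      probReal_univ, one_smul]
    have hMt : ∫ y, N.potential θ y ∂(N.stateLaw p x t) < M := hM t
    exact le_mul_of_one_le_right (Real.exp_pos _).le (by linarith)
  · rw [integral_add (hI t) (hE t)]
    refine add_le_add (hM t).le ?_
    calc ∫ y, Real.exp (-N.potential θ y) ∂(N.stateLaw p x t)
        ≤ ∫ _, (1 : ℝ) ∂(N.stateLaw p x t) := by
          refine integral_mono_ae (hE t) (integrable_const _) ?_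
          filter_upwards [N.ae_stateLaw_mem p hx t] with y hy
          exact Real.exp_le_one_iff.2 (neg_nonpos.2 (N.potential_nonneg hθ hy))
      _ = 1 := by simp

lemma ofReal_meanPotential_le (p : ℝ) {θ : Fin 2 → ℝ} (hθ : ∀ e, θ e ∈ Set.Icc (0 : ℝ) 1)
    {x : TrafficState} (hx : x ∈ N.stateSpace) (t : ℕ) :
    ENNReal.ofReal (N.meanPotential p θ x t / ((∑ i, N.length i) / N.timeStep)) ≤
      N.meanDensity p x t := by
  set K := (∑ i, N.length i) / N.timeStep with hK
  have hKpos : 0 < K := div_pos (Finset.sum_pos (fun i _ => N.length_pos i)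
    Finset.univ_nonempty) N.timeStep_pos
  have hI := N.integrable_potential p hθ hx t
  rw [meanPotential, ← integral_div, ofReal_integral_eq_lintegral_ofReal (hI.div_const K)
    ((N.ae_stateLaw_mem p hx t).mono fun y hy => div_nonneg (N.potential_nonneg hθ hy) hKpos.le)]
  refine lintegral_mono fun y => ENNReal.ofReal_le_ofReal ?_
  rw [div_le_iff₀ hKpos, mul_comm]
  exact N.potential_le hθ y

lemma le_averageDensity {p : ℝ} {x : TrafficState} {B : ℝ≥0∞}
    (h : ∀ t, B ≤ N.meanDensity p x t) {t : ℕ} (ht : t ≠ 0) : B ≤ N.averageDensity p x t := by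
  rw [averageDensity, ENNReal.le_div_iff_mul_le (by simp [ht]) (by simp)]
  calc B * t = ∑ _τ ∈ Finset.range t, B := by simp [mul_comm]
    _ ≤ _ := Finset.sum_le_sum fun τ _ => h τ

lemma tendsto_averageDensity {p : ℝ} {x : TrafficState}
    (h : Tendsto (N.meanDensity p x) atTop (𝓝 ⊤)) :
    Tendsto (N.averageDensity p x) atTop (𝓝 ⊤) := by
  rw [ENNReal.tendsto_nhds_top_iff_nat] at h ⊢
  intro n
  obtain ⟨T, hT⟩ := eventually_atTop.1 (h (2 * (n + 1)))
  filter_upwards [eventually_ge_atTop (2 * T + 1)] with t ht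
  refine lt_of_lt_of_le (b := ((n + 1 : ℕ) : ℝ≥0∞)) (by exact_mod_cast n.lt_succ_self) ?_
  rw [averageDensity, ENNReal.le_div_iff_mul_le (by simp; omega) (by simp)]
  -- At least half of the times before `t` are at least `T`.
  calc ((n + 1 : ℕ) : ℝ≥0∞) * t ≤ ((t - T : ℕ) : ℝ≥0∞) * ((2 * (n + 1) : ℕ) : ℝ≥0∞) := by
        have hle : t ≤ 2 * (t - T) := by omega
        norm_cast
        calc (n + 1) * t ≤ (n + 1) * (2 * (t - T)) := Nat.mul_le_mul_left _ hle
          _ = (t - T) * (2 * (n + 1)) := by ring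
    _ = ∑ _τ ∈ Finset.Ico T t, ((2 * (n + 1) : ℕ) : ℝ≥0∞) := by simp
    _ ≤ ∑ τ ∈ Finset.Ico T t, N.meanDensity p x τ :=
        Finset.sum_le_sum fun τ hτ => (hT τ (Finset.mem_Ico.1 hτ).1).le
    _ ≤ ∑ τ ∈ Finset.range t, N.meanDensity p x τ :=
        Finset.sum_le_sum_of_subset fun τ hτ => Finset.mem_range.2 (Finset.mem_Ico.1 hτ).2

end

end TrafficNetwork

theorem theorem2 (N : TrafficNetwork) (p : ℝ) (θ : Fin 2 → ℝ) (γ : ℝ)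
    (hθ : ∀ e, θ e ∈ Set.Icc (0 : ℝ) 1) (hγ : 0 ≤ γ)
    (hflow : ∀ x ∈ N.stateSpace, x 0 = N.criticalDensity → γ ≤ N.netFlow p θ x) :
    N.Unstable p ∧
      ((0 < γ ∨ ∀ d : ℝ, N.demand ≠ Measure.dirac d) →
        ∀ x ∈ N.stateSpace, Tendsto (N.averageDensity p x) atTop (𝓝 ⊤)) := by
  have hdrift : ∀ x ∈ N.stateSpace, γ ≤ N.netFlow p θ x := fun x hx => N.le_netFlow hθ hflow hx
  have hKpos : 0 < (∑ i, N.length i) / N.timeStep :=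
    div_pos (Finset.sum_pos (fun i _ => N.length_pos i) Finset.univ_nonempty) N.timeStep_pos
  refine ⟨?_, fun h x hx => N.tendsto_averageDensity ?_⟩
  · rintro ⟨Z, hZ⟩
    set K := (∑ i, N.length i) / N.timeStep with hK
    -- Start with empty branches and a potential of `K * (Z + 1)` on the upstream link.
    set x : TrafficState := ![N.timeStep / N.length 0 * (K * (Z + 1)), 0, 0] with hxdef
    have hx : x ∈ N.stateSpace := by
      refine ⟨?_, fun e => ?_⟩
      · have := N.timeStep_pos
        have := N.length_pos 0
        change 0 ≤ N.timeStep / N.length 0 * (K * (Z + 1))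
        positivity
      · fin_cases e <;> exact ⟨le_rfl, (N.jam_pos _).le⟩
    have hVx : N.potential θ x = K * (Z + 1) := by
      have := N.timeStep_pos.ne'
      have := (N.length_pos 0).ne'
      simp only [TrafficNetwork.potential, hxdef, Fin.sum_univ_two]
      simp
      field_simp
    have hmono : Monotone (N.meanPotential p θ x) :=
      monotone_nat_of_le_succ fun t => by linarith [N.meanPotential_add_le hθ hdrift hx t]
    have hB : ∀ t, ((Z + 1 : ℝ≥0) : ℝ≥0∞) ≤ N.meanDensity p x t := fun t => by
      refine le_trans ?_ (N.ofReal_meanPotential_le p hθ hx t)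
      rw [← ENNReal.ofReal_coe_nnreal]
      refine ENNReal.ofReal_le_ofReal ?_
      rw [le_div_iff₀ hKpos, mul_comm]
      have h0 := hmono (Nat.zero_le t)
      rw [N.meanPotential_zero, hVx] at h0
      exact_mod_cast h0
    have hlim : ((Z + 1 : ℝ≥0) : ℝ≥0∞) ≤ limsup (N.averageDensity p x) atTop :=
      le_trans (le_liminf_of_le (by isBoundedDefault) ((eventually_ne_atTop 0).mono fun t ht =>
        N.le_averageDensity hB ht)) liminf_le_limsup
    exact absurd (ENNReal.coe_le_coe.1 (hlim.trans (hZ x hx))) (not_le.2 (lt_add_one Z))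
  · have htop : Tendsto (fun t => ENNReal.ofReal
        (N.meanPotential p θ x t / ((∑ i, N.length i) / N.timeStep))) atTop (𝓝 ⊤) :=
      ENNReal.tendsto_ofReal_atTop.comp
        ((N.tendsto_meanPotential hθ hγ hdrift h hx).atTop_div_const hKpos)
    exact tendsto_nhds_top_mono htop (.of_forall (N.ofReal_meanPotential_le p hθ hx))
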